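/- Throughout, $\log=\log_2$. A state on a finite-dimensional Hilbert space is a positive semidefinite operator of trace $1$; a quantum channel $T:\mathcal B(\mathbb C^{d})\to\mathcal B(\mathbb C^{\Delta})$ is a completely positive, trace-preserving linear map; $\operatorname{supp}\rho$ denotes the orthogonal projection onto the range of $\rho$. An identification code on $\mathcal B(\mathcal H)$ with error probability $\lambda_1$ of the first kind and $\lambda_2$ of the second kind is a family $(\rho_i,D_i)_{i=1,\dots,N}$ of states $\rho_i$ on $\mathcal H$ and operators $0\le D_i\le \mathbf 1$ on $\mathcal H$ such that $\operatorname{Tr}(\rho_iD_i)\ge 1-\lambda_1$ for all $i$ and $\operatorname{Tr}(\rho_iD_j)\le\lambda_2$ for all $i\ne j$. **Proposition.** Let $\lambda>0$ be real, let $d\ge 2$ and $\Delta\ge 1$ be integers with $$\Delta\ \ge\ \Bigl(\frac{900}{\lambda^2}\,\log\frac{30d}{\lambda}\Bigr)\log d ,$$ and let $\Phi_d=|\Phi_d\rangle\langle\Phi_d|$ with $|\Phi_d\rangle=\frac1{\sqrt d}\sum_{j=1}^d|j\rangle|j\rangle\in\mathbb C^d\otimes\mathbb C^d$. Then there exist quantum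 channels $T_i:\mathcal B(\mathbb C^d)\to\mathcal B(\mathbb C^\Delta)$, $i=1,\dots,N'=\bigl\lceil\tfrac12\,2^{d^2}\bigr\rceil$, such that the states $\rho_i=(\mathrm{id}\otimes T_i)\Phi_d$ together with the operators $D_i=\operatorname{supp}\rho_i$ form an identification code on $\mathcal B(\mathbb C^d\otimes\mathbb C^\Delta)$ with error probability of the first kind $0$ and error probability of the second kind $\lambda$. In other words, a sender and a receiver who share the maximally entangled state $\Phi_d$ can use the transmission of a $\Delta$-dimensional system to build an identification code with $\lceil\frac12\,2^{d^2}\rceil$ messages. -/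

import Mathlib

open scoped ComplexOrder

noncomputable section

namespace QuantumID

/-- The operator `(id ⊗ T) M`, where `M` is an operator on `ℂ^α ⊗ ℂ^ι`, viewed as an `α × α` block
matrix with blocks in `B(ℂ^ι)`: the map `T` is applied to each block. -/
def idTensor {α ι κ : Type*} (T : Matrix ι ι ℂ →ₗ[ℂ] Matrix κ κ ℂ)
    (M : Matrix (α × ι) (α × ι) ℂ) : Matrix (α × κ) (α × κ) ℂ :=
  Matrix.of fun p q => T (Matrix.of fun k l => M (p.1, k) (q.1, l)) p.2 q.2

section CompletelyPositive

open scoped MatrixOrder Matrix.Norms.L2Operator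

/-- `T` is completely positive, as a map between the C*-algebras `B(ℂ^ι)` and `B(ℂ^κ)` (the
matrix algebras with the operator norm and the Loewner order). -/
def IsCompletelyPositive {ι κ : Type*} [Fintype ι] [DecidableEq ι] [Fintype κ] [DecidableEq κ]
    (T : Matrix ι ι ℂ →ₗ[ℂ] Matrix κ κ ℂ) : Prop :=
  ∃ Ψ : CompletelyPositiveMap (Matrix ι ι ℂ) (Matrix κ κ ℂ), Ψ.toLinearMap = T

theorem cstarMatrix_nonneg_iff {ι : Type*} [Fintype ι] [DecidableEq ι] {k : ℕ}
    (M : CStarMatrix (Fin k) (Fin k) (Matrix ι ι ℂ)) :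
    0 ≤ M ↔ (Matrix.of fun p q : Fin k × ι => M p.1 q.1 p.2 q.2).PosSemidef := by
  constructor
  · intro hM
    rw [StarOrderedRing.nonneg_iff] at hM
    induction hM using AddSubmonoid.closure_induction with
    | mem x hx =>
      obtain ⟨N, rfl⟩ := hx
      convert Matrix.posSemidef_conjTranspose_mul_self
        (Matrix.of fun p q : Fin k × ι => N p.1 q.1 p.2 q.2) using 1
      ext p q
      simp [CStarMatrix.mul_apply, Matrix.mul_apply, Matrix.sum_apply, Fintype.sum_prod_type,
        Matrix.conjTranspose_apply, CStarMatrix.star_apply, Matrix.star_apply]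
    | zero => exact Matrix.PosSemidef.zero
    | add x y _ _ hx hy => exact hx.add hy
  · intro h
    obtain ⟨B, hB⟩ := CStarAlgebra.nonneg_iff_eq_star_mul_self.mp h.nonneg
    let N : CStarMatrix (Fin k) (Fin k) (Matrix ι ι ℂ) :=
      CStarMatrix.ofMatrix (Matrix.of fun a b => Matrix.of fun i j => B (a, i) (b, j))
    have : M = star N * N := by
      ext a b i j
      have := congrFun (congrFun hB (a, i)) (b, j)
      simp [N, CStarMatrix.mul_apply, Matrix.mul_apply, Matrix.sum_apply, Fintype.sum_prod_type,
        CStarMatrix.star_apply, Matrix.star_apply] at this ⊢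
      exact this
    rw [this]
    exact star_mul_self_nonneg _

/-- `T` is completely positive if and only if all `id_n ⊗ T` preserve positive semidefiniteness. -/
theorem isCompletelyPositive_iff {ι κ : Type*} [Fintype ι] [DecidableEq ι] [Fintype κ]
    [DecidableEq κ] (T : Matrix ι ι ℂ →ₗ[ℂ] Matrix κ κ ℂ) :
    IsCompletelyPositive T ↔ ∀ (n : ℕ) (M : Matrix (Fin n × ι) (Fin n × ι) ℂ),
      M.PosSemidef → (idTensor T M).PosSemidef := by
  constructor
  · rintro ⟨Ψ, rfl⟩ n M hM
    exact (cstarMatrix_nonneg_iff _).1 (Ψ.map_cstarMatrix_nonneg' n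
      (CStarMatrix.ofMatrix (Matrix.of fun a b => Matrix.of fun i j => M (a, i) (b, j)))
      ((cstarMatrix_nonneg_iff _).2 hM))
  · intro h
    exact ⟨⟨T, fun n M hM => (cstarMatrix_nonneg_iff _).2
      (h n _ ((cstarMatrix_nonneg_iff _).1 hM))⟩, rfl⟩

end CompletelyPositive

/-- A quantum channel `B(ℂ^ι) → B(ℂ^κ)`: a completely positive, trace preserving linear map. -/
structure IsQuantumChannel {ι κ : Type*} [Fintype ι] [DecidableEq ι] [Fintype κ] [DecidableEq κ]
    (T : Matrix ι ι ℂ →ₗ[ℂ] Matrix κ κ ℂ) : Prop where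
  completelyPositive : IsCompletelyPositive T
  tracePreserving : ∀ A : Matrix ι ι ℂ, (T A).trace = A.trace

/-- A state: a positive semidefinite operator of trace `1`. -/
structure IsState {ι : Type*} [Fintype ι] (ρ : Matrix ι ι ℂ) : Prop where
  posSemidef : ρ.PosSemidef
  trace_eq_one : ρ.trace = 1

/-- The support projector `supp ρ`: the orthogonal projection onto the range of `ρ`. For
positive semidefinite `ρ` the range is the span of the eigenvectors with nonzero eigenvalue. -/
def suppProj {ι : Type*} [Fintype ι] [DecidableEq ι] (ρ : Matrix ι ι ℂ) : Matrix ι ι ℂ :=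
  (Matrix.toEuclideanCLM (n := ι) (𝕜 := ℂ)).symm
    (Matrix.toEuclideanLin ρ).range.starProjection

/-- The vector `d^{-1/2} ∑ j, |j⟩|j⟩` of `ℂ^d ⊗ ℂ^d`. -/
def maxEntangledVec (d : ℕ) : Fin d × Fin d → ℂ :=
  fun p => if p.1 = p.2 then (((1 / Real.sqrt d : ℝ)) : ℂ) else 0

/-- The maximally entangled state `Φ_d = |Φ_d⟩⟨Φ_d|`. -/
def maxEntangledState (d : ℕ) : Matrix (Fin d × Fin d) (Fin d × Fin d) ℂ :=
  Matrix.vecMulVec (maxEntangledVec d) (star (maxEntangledVec d))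

/-- `(ρ i, D i)`, `i ∈ I`, is an identification code for the channel `T`, with error
probability `l₁` of the first and `l₂` of the second kind. -/
structure IsIDCode {I ι κ : Type*} [Fintype ι] [Fintype κ] [DecidableEq κ]
    (T : Matrix ι ι ℂ →ₗ[ℂ] Matrix κ κ ℂ) (ρ : I → Matrix ι ι ℂ) (D : I → Matrix κ κ ℂ)
    (l₁ l₂ : ℝ) : Prop where
  isState : ∀ i, IsState (ρ i)
  decoder_nonneg : ∀ i, (D i).PosSemidef
  decoder_le_one : ∀ i, (1 - D i).PosSemidef
  first_kind : ∀ i, 1 - l₁ ≤ (T (ρ i) * D i).trace.re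
  second_kind : ∀ i j, i ≠ j → (T (ρ i) * D j).trace.re ≤ l₂

/-- An identification code on `B(ℂ^ι)`: an identification code for the identity channel. -/
def IsIDCodeOn {I ι : Type*} [Fintype ι] [DecidableEq ι]
    (ρ D : I → Matrix ι ι ℂ) (l₁ l₂ : ℝ) : Prop :=
  IsIDCode (LinearMap.id : Matrix ι ι ℂ →ₗ[ℂ] Matrix ι ι ℂ) ρ D l₁ l₂

end QuantumID

end

open scoped Matrix Kronecker

namespace QuantumID

/-! The codewords come from random sign matrices. A matrix `V` from `ℂ^d` to `ℂ^Δ ⊗ ℂ^K` with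
independent entries `±1/√(ΔK)` is nearly an isometry, since its columns are nearly orthogonal
(`card_signMatrix_near_isometry`); `exists_isometry_near` replaces it by a true isometry `W`, the
Stinespring operator of a channel. The resulting state has rank at most `K`, so its support is a
small subspace of `ℂ^d ⊗ ℂ^Δ`.

Fix one such support. The overlap of another random state with it is a quadratic form in `dΔK`
signs, and its exponential moment shows that it exceeds `λ/4` with probability at most `exp(K² -
λdΔK/16)` (`card_signMatrix_large_overlap_le`). For `K ≤ λdΔ/32` this is at most `exp(-λdΔK/32)`. So
in the digraph of pairs whose overlap is too large, all in-degrees are a tiny fraction of the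
vertices, and a greedy choice (`exists_independent_of_inDegree_le`) finds up to `2^(d²)` pairwise
compatible codewords. Choosing `K` of order `λdΔ` makes the exponent a large multiple of `d²`. -/

/-- The squared Frobenius (Hilbert-Schmidt) norm. -/
noncomputable def frobSq {m n : Type*} [Fintype m] [Fintype n] (M : Matrix m n ℂ) : ℝ :=
  ∑ i, ∑ j, ‖M i j‖ ^ 2

/-! ### Frobenius norm and isometries -/

section Frobenius

variable {m n p : Type*} [Fintype m] [Fintype n] [Fintype p]

theorem frobSq_nonneg (M : Matrix m n ℂ) : 0 ≤ frobSq M := by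
  unfold frobSq; positivity

theorem trace_conjTranspose_mul_self_eq_frobSq (M : Matrix m n ℂ) :
    (Mᴴ * M).trace = (frobSq M : ℂ) := by
  simp only [frobSq, Matrix.trace, Matrix.diag, Matrix.mul_apply, Matrix.conjTranspose_apply]
  rw [Finset.sum_comm]
  push_cast
  refine Finset.sum_congr rfl fun i _ => Finset.sum_congr rfl fun j _ => ?_
  exact RCLike.conj_mul (M i j)

theorem frobSq_eq_of_gram_eq {M : Matrix m n ℂ} {N : Matrix p n ℂ} (h : Mᴴ * M = Nᴴ * N) :
    frobSq M = frobSq N := by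
  have := trace_conjTranspose_mul_self_eq_frobSq M
  rw [h, trace_conjTranspose_mul_self_eq_frobSq] at this
  exact_mod_cast this.symm

theorem frobSq_conjTranspose (M : Matrix m n ℂ) : frobSq Mᴴ = frobSq M := by
  simp only [frobSq, Matrix.conjTranspose_apply, norm_star]
  exact Finset.sum_comm

theorem frobSq_isometry_mul [DecidableEq n] (U : Matrix m n ℂ) (hU : Uᴴ * U = 1)
    (M : Matrix n p ℂ) : frobSq (U * M) = frobSq M := by
  apply frobSq_eq_of_gram_eq
  rw [Matrix.conjTranspose_mul, Matrix.mul_assoc, ← Matrix.mul_assoc Uᴴ, hU, Matrix.one_mul]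

theorem frobSq_mul_coisometry [DecidableEq n] (M : Matrix m n ℂ) (U : Matrix n p ℂ)
    (hU : U * Uᴴ = 1) : frobSq (M * U) = frobSq M := by
  rw [← frobSq_conjTranspose, Matrix.conjTranspose_mul, frobSq_isometry_mul, frobSq_conjTranspose]
  simpa using hU

theorem isometry_compl_idempotent [DecidableEq m] [DecidableEq n] (U : Matrix m n ℂ)
    (hU : Uᴴ * U = 1) : (1 - U * Uᴴ)ᴴ * (1 - U * Uᴴ) = 1 - U * Uᴴ := by
  have h : U * Uᴴ * (U * Uᴴ) = U * Uᴴ := by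
    rw [Matrix.mul_assoc, ← Matrix.mul_assoc Uᴴ, hU, Matrix.one_mul]
  simp [Matrix.sub_mul, Matrix.mul_sub, h]

/-- Pythagoras: the missing part is the squared norm of the component of `M` orthogonal to the range
of `U`. -/
theorem frobSq_conjTranspose_isometry_mul_le [DecidableEq m] [DecidableEq n] (U : Matrix m n ℂ)
    (hU : Uᴴ * U = 1) (M : Matrix m p ℂ) : frobSq (Uᴴ * M) ≤ frobSq M := by
  have h : (((1 - U * Uᴴ) * M)ᴴ * ((1 - U * Uᴴ) * M)) = Mᴴ * M - (Uᴴ * M)ᴴ * (Uᴴ * M) := by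
    rw [Matrix.conjTranspose_mul, Matrix.mul_assoc, ← Matrix.mul_assoc (1 - U * Uᴴ)ᴴ,
      isometry_compl_idempotent U hU]
    simp [Matrix.sub_mul, Matrix.mul_sub, Matrix.mul_assoc]
  have h2 := congrArg Matrix.trace h
  rw [Matrix.trace_sub] at h2
  simp only [trace_conjTranspose_mul_self_eq_frobSq] at h2
  have h3 : frobSq ((1 - U * Uᴴ) * M) = frobSq M - frobSq (Uᴴ * M) := by exact_mod_cast h2
  linarith [frobSq_nonneg ((1 - U * Uᴴ) * M)]

theorem frobSq_add_le (M N : Matrix m n ℂ) : frobSq (M + N) ≤ 2 * frobSq M + 2 * frobSq N := by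
  simp only [frobSq, Finset.mul_sum, ← Finset.sum_add_distrib]
  refine Finset.sum_le_sum fun i _ => Finset.sum_le_sum fun j _ => ?_
  have := norm_add_le (M i j) (N i j)
  have h0 := norm_nonneg (M i j + N i j)
  rw [Matrix.add_apply]
  nlinarith [sq_nonneg (‖M i j‖ - ‖N i j‖)]

end Frobenius

/-! ### Nearest isometry, via the polar decomposition -/

section Polar

variable {Y ι : Type*} [Fintype Y] [Fintype ι] [DecidableEq ι]

/-- Orthogonal columns are multiples of orthonormal columns. -/
theorem exists_isometry_of_gram_diagonal (hcard : Fintype.card ι ≤ Fintype.card Y)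
    (V : Matrix Y ι ℂ) (s : ι → ℝ) (hs : Vᴴ * V = Matrix.diagonal fun j => (s j : ℂ)) :
    ∃ w : Matrix Y ι ℂ, wᴴ * w = 1 ∧ ∀ y j, V y j = (Real.sqrt (s j) : ℂ) * w y j := by
  classical
  obtain ⟨e⟩ : Nonempty (ι ↪ Fin (Fintype.card Y)) :=
    Function.Embedding.nonempty_of_card_le (by simpa using hcard)
  let c : ι → EuclideanSpace ℂ Y := fun j => WithLp.toLp 2 (V.col j)
  have hc : ∀ j k, inner ℂ (c j) (c k) = if j = k then (s j : ℂ) else 0 := by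
    intro j k
    have := congrFun (congrFun hs j) k
    rw [Matrix.diagonal_apply] at this
    rw [← this]
    simp [c, PiLp.inner_apply, Matrix.mul_apply, mul_comm]
  have hn : ∀ j, ‖c j‖ = Real.sqrt (s j) := by
    intro j
    have h1 := hc j j
    rw [inner_self_eq_norm_sq_to_K, if_pos rfl] at h1
    have h2 : ‖c j‖ ^ 2 = s j := Complex.ofReal_injective (by simpa using h1)
    rw [← h2, Real.sqrt_sq (norm_nonneg _)]
  -- Padding with zero vectors lets Gram–Schmidt return a full orthonormal basis: nonzero columns
  -- are only normalised, and zero columns receive arbitrary orthonormal vectors.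
  let f : Fin (Fintype.card Y) → EuclideanSpace ℂ Y := Function.extend e c 0
  have hfe : ∀ j, f (e j) = c j := fun j => e.injective.extend_apply _ _ _
  have hf0 : ∀ x, (¬ ∃ j, e j = x) → f x = 0 := fun x hx => by
    simp [f, Function.extend_apply' _ _ _ hx]
  have horth : Pairwise fun x y => inner ℂ (f x) (f y) = 0 := by
    intro x y hxy
    by_cases hx : ∃ j, e j = x
    · obtain ⟨j, rfl⟩ := hx
      by_cases hy : ∃ k, e k = y
      · obtain ⟨k, rfl⟩ := hy
        have : j ≠ k := fun h => hxy (by rw [h])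
        simp [hfe, hc, this]
      · simp [hf0 y hy]
    · simp [hf0 x hx]
  have hfr : Module.finrank ℂ (EuclideanSpace ℂ Y) = Fintype.card (Fin (Fintype.card Y)) := by
    simp
  let b := InnerProductSpace.gramSchmidtOrthonormalBasis hfr f
  refine ⟨Matrix.of fun y j => b (e j) y, ?_, ?_⟩
  · ext j k
    have := orthonormal_iff_ite.mp b.orthonormal (e j) (e k)
    simp only [e.injective.eq_iff] at this
    rw [Matrix.one_apply, ← this]
    simp [PiLp.inner_apply, Matrix.mul_apply, mul_comm]
  · intro y j
    by_cases h0 : c j = 0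
    · have h1 : Real.sqrt (s j) = 0 := by rw [← hn, h0, norm_zero]
      have h2 : V y j = c j y := rfl
      simp [h1, h2, h0]
    · have h1 : b (e j) = ((‖f (e j)‖⁻¹ : ℝ) : ℂ) • f (e j) := by
        have := InnerProductSpace.gramSchmidtOrthonormalBasis_apply_of_orthogonal hfr horth
          (i := e j) (by rwa [hfe])
        simpa [b] using this
      have h3 : (Real.sqrt (s j) : ℂ) ≠ 0 := by
        rw [← hn]; exact_mod_cast norm_ne_zero_iff.mpr h0
      have h2 : V y j = c j y := rfl
      rw [hfe, hn] at h1
      rw [h2, Matrix.of_apply, h1]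
      simp [h3]

/-- Every matrix is close to an isometry if its Gram matrix is close to the identity. -/
theorem exists_isometry_near (hcard : Fintype.card ι ≤ Fintype.card Y) (V : Matrix Y ι ℂ) :
    ∃ W : Matrix Y ι ℂ, Wᴴ * W = 1 ∧ frobSq (W - V) ≤ frobSq (Vᴴ * V - 1) := by
  have hS : (Vᴴ * V).IsHermitian := Matrix.isHermitian_conjTranspose_mul_self V
  have hpos : ∀ j, 0 ≤ hS.eigenvalues j :=
    (Matrix.posSemidef_conjTranspose_mul_self V).eigenvalues_nonneg
  set s := hS.eigenvalues with hsdef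
  let U : Matrix ι ι ℂ := hS.eigenvectorUnitary
  have hU1 : Uᴴ * U = 1 := by
    simpa [Matrix.star_eq_conjTranspose] using Unitary.coe_star_mul_self hS.eigenvectorUnitary
  have hU2 : U * Uᴴ = 1 := by
    simpa [Matrix.star_eq_conjTranspose] using Unitary.coe_mul_star_self hS.eigenvectorUnitary
  have hspec : Uᴴ * (Vᴴ * V) * U = Matrix.diagonal fun j => (s j : ℂ) := by
    have := hS.spectral_theorem
    rw [Unitary.conjStarAlgAut_apply] at this
    have h2 : Vᴴ * V = U * (Matrix.diagonal fun j => (s j : ℂ)) * Uᴴ := this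
    rw [h2, Matrix.mul_assoc, Matrix.mul_assoc, Matrix.mul_assoc, hU1, Matrix.mul_one,
      ← Matrix.mul_assoc, hU1, Matrix.one_mul]
  -- In an eigenbasis of `Vᴴ * V` the columns of `V` become orthogonal, so `w * Uᴴ` is the isometric
  -- factor of a polar decomposition; both distances reduce to sums over the eigenvalues.
  obtain ⟨w, hw1, hw2⟩ := exists_isometry_of_gram_diagonal hcard (V * U) s
    (by rw [← hspec, Matrix.conjTranspose_mul]; simp only [Matrix.mul_assoc])
  refine ⟨w * Uᴴ, ?_, ?_⟩
  · rw [Matrix.conjTranspose_mul, Matrix.conjTranspose_conjTranspose, Matrix.mul_assoc,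
      ← Matrix.mul_assoc wᴴ, hw1, Matrix.one_mul, hU2]
  · have e1 : frobSq (w * Uᴴ - V) = frobSq (w - V * U) := by
      rw [← frobSq_mul_coisometry (w * Uᴴ - V) U hU2, Matrix.sub_mul, Matrix.mul_assoc, hU1,
        Matrix.mul_one]
    have e2 : frobSq (Vᴴ * V - 1) = ∑ j, (s j - 1) ^ 2 := by
      rw [← frobSq_mul_coisometry (Vᴴ * V - 1) U hU2,
        ← frobSq_isometry_mul Uᴴ (by simpa using hU2), ← Matrix.mul_assoc, Matrix.mul_sub,
        Matrix.sub_mul, hspec, Matrix.mul_one, hU1]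
      unfold frobSq
      refine Finset.sum_congr rfl fun j _ => ?_
      rw [Finset.sum_eq_single j]
      · have : (Matrix.diagonal (fun j => (s j : ℂ)) - 1) j j = ((s j - 1 : ℝ) : ℂ) := by simp
        rw [this, Complex.norm_real, Real.norm_eq_abs, sq_abs]
      · intro k _ hk
        simp [Matrix.diagonal_apply_ne' _ hk, Matrix.one_apply_ne' hk]
      · simp
    have hcol : ∀ j, ∑ y, ‖w y j‖ ^ 2 = 1 := by
      intro j
      have := congrFun (congrFun hw1 j) j
      rw [Matrix.mul_apply, Matrix.one_apply_eq] at this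
      have h2 : ((∑ y, ‖w y j‖ ^ 2 : ℝ) : ℂ) = 1 := by
        rw [← this]; push_cast
        exact Finset.sum_congr rfl fun y _ => (RCLike.conj_mul (w y j)).symm
      exact_mod_cast h2
    have e3 : frobSq (w - V * U) = ∑ j, (1 - Real.sqrt (s j)) ^ 2 := by
      unfold frobSq
      rw [Finset.sum_comm]
      refine Finset.sum_congr rfl fun j _ => ?_
      refine Eq.trans ?_ (mul_one ((1 - Real.sqrt (s j)) ^ 2))
      refine Eq.trans ?_ (congrArg _ (hcol j))
      rw [Finset.mul_sum]
      refine Finset.sum_congr rfl fun y _ => ?_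
      have : (w - V * U) y j = ((1 - Real.sqrt (s j) : ℝ) : ℂ) * w y j := by
        rw [Matrix.sub_apply, hw2]; push_cast; ring
      rw [this, norm_mul, mul_pow, Complex.norm_real, Real.norm_eq_abs, sq_abs]
    rw [e1, e2, e3]
    refine Finset.sum_le_sum fun j _ => ?_
    have h1 := Real.sqrt_nonneg (s j)
    have h2 := Real.mul_self_sqrt (hpos j)
    have h3 : (s j - 1) ^ 2 = (1 - Real.sqrt (s j)) ^ 2 * (1 + Real.sqrt (s j)) ^ 2 := by
      rw [← mul_pow, ← neg_sq]; congr 1; linarith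
    rw [h3]
    exact le_mul_of_one_le_right (sq_nonneg _) (by nlinarith)

end Polar

/-! ### Support projections -/

/-- The support projection in terms of an orthonormal basis of the range. -/
theorem exists_isometry_suppProj {ι : Type*} [Fintype ι] [DecidableEq ι] (ρ : Matrix ι ι ℂ) :
    ∃ U : Matrix ι (Fin ρ.rank) ℂ, Uᴴ * U = 1 ∧ suppProj ρ = U * Uᴴ ∧ suppProj ρ * ρ = ρ := by
  set L := (Matrix.toEuclideanLin ρ).range with hL
  have hr : Module.finrank ℂ L = ρ.rank := by
    rw [Matrix.rank_eq_finrank_range_toLin ρ (EuclideanSpace.basisFun ι ℂ).toBasis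
      (EuclideanSpace.basisFun ι ℂ).toBasis, hL]
    rw [Matrix.toEuclideanLin_eq_toLin_orthonormal]
  let b : OrthonormalBasis (Fin ρ.rank) ℂ L :=
    (stdOrthonormalBasis ℂ L).reindex (finCongr hr)
  refine ⟨Matrix.of fun x a => (b a : EuclideanSpace ℂ ι) x, ?_, ?_, ?_⟩
  · ext j k
    have := orthonormal_iff_ite.mp b.orthonormal j k
    rw [Matrix.one_apply, ← this]
    simp [PiLp.inner_apply, Matrix.mul_apply, mul_comm]
  · have hP := b.starProjection_eq_sum_rankOne
    rw [suppProj, StarAlgEquiv.symm_apply_eq]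
    refine hP.trans ?_
    ext v x
    simp [Matrix.mulVec, dotProduct, Matrix.mul_apply, PiLp.inner_apply, Finset.sum_mul]
    rw [Finset.sum_comm]
    refine Finset.sum_congr rfl fun a _ => Finset.sum_congr rfl fun b _ => ?_
    ring
  · apply (Matrix.toEuclideanCLM (n := ι) (𝕜 := ℂ)).injective
    have hP : Matrix.toEuclideanCLM (n := ι) (𝕜 := ℂ) (suppProj ρ) = L.starProjection :=
      StarAlgEquiv.apply_symm_apply _ _
    refine (map_mul (Matrix.toEuclideanCLM (n := ι) (𝕜 := ℂ)) _ _).trans ?_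
    rw [hP]
    ext1 v
    exact Submodule.starProjection_eq_self_iff.mpr ⟨v, rfl⟩

/-! ### Random signs: exponential moments and tail bounds -/

/-- The value `±1` of a bit. -/
def boolSign (b : Bool) : ℝ := if b then 1 else -1

theorem boolSign_mul_self (b : Bool) : boolSign b * boolSign b = 1 := by
  cases b <;> simp [boolSign]

theorem boolSign_not (b : Bool) : boolSign (!b) = -boolSign b := by
  cases b <;> simp [boolSign]

/-- Completing the square. This Gaussian linearisation turns the exponential of a square into an
average of exponentials linear in `z`, which factor over independent signs. -/
theorem exp_sq_div_four_eq_integral (z : ℝ) :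
    Real.exp (z ^ 2 / 4) = (Real.sqrt Real.pi)⁻¹ * ∫ g : ℝ, Real.exp (-g ^ 2 + g * z) := by
  have h1 : ∀ g : ℝ, Real.exp (-g ^ 2 + g * z)
      = Real.exp (z ^ 2 / 4) * Real.exp (-1 * (g - z / 2) ^ 2) := by
    intro g; rw [← Real.exp_add]; congr 1; ring
  simp_rw [h1]
  rw [MeasureTheory.integral_const_mul,
    MeasureTheory.integral_sub_right_eq_self (fun g : ℝ => Real.exp (-1 * g ^ 2)),
    integral_gaussian, div_one]
  have : Real.sqrt Real.pi ≠ 0 := by positivity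
  field_simp

theorem integrable_exp_neg_sq_add_mul (z : ℝ) :
    MeasureTheory.Integrable fun g : ℝ => Real.exp (-g ^ 2 + g * z) := by
  have h1 : ∀ g : ℝ, Real.exp (-g ^ 2 + g * z)
      = Real.exp (z ^ 2 / 4) * Real.exp (-1 * (g - z / 2) ^ 2) := by
    intro g; rw [← Real.exp_add]; congr 1; ring
  simp_rw [h1]
  exact ((integrable_exp_neg_mul_sq one_pos).comp_sub_right (z / 2)).const_mul _

/-- By independence the sum factors into terms `2 cosh (c x)`, and `cosh t ≤ exp (t²/2)`. -/
theorem sum_exp_linear_boolSign_le {ι : Type*} [Fintype ι] [DecidableEq ι] (c : ι → ℝ) :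
    ∑ ε : ι → Bool, Real.exp (∑ x, c x * boolSign (ε x))
      ≤ 2 ^ Fintype.card ι * Real.exp ((∑ x, c x ^ 2) / 2) := by
  have h1 : ∑ ε : ι → Bool, Real.exp (∑ x, c x * boolSign (ε x))
      = ∏ x, ∑ b : Bool, Real.exp (c x * boolSign b) := by
    simp_rw [Real.exp_sum]
    exact (Fintype.prod_sum fun x b => Real.exp (c x * boolSign b)).symm
  have h2 : 2 ^ Fintype.card ι * Real.exp ((∑ x, c x ^ 2) / 2)
      = ∏ x, 2 * Real.exp (c x ^ 2 / 2) := by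
    rw [Finset.prod_mul_distrib, ← Real.exp_sum, Finset.sum_div]; simp
  rw [h1, h2]
  refine Finset.prod_le_prod (fun x _ => by positivity) fun x _ => ?_
  have := Real.cosh_le_exp_half_sq (c x)
  rw [Real.cosh_eq] at this
  simp [boolSign]
  linarith

/-- Exponential moment of the squared length of the projection of a random sign vector, for real
vectors `y a` with Gram matrix at most `1`. -/
theorem sum_exp_quarter_sq_le {ι A : Type*} [Fintype ι] [DecidableEq ι] [Fintype A]
    (y : A → ι → ℝ) (hy : ∀ g : A → ℝ, ∑ x, (∑ a, g a * y a x) ^ 2 ≤ ∑ a, g a ^ 2) :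
    ∑ ε : ι → Bool, Real.exp ((∑ a, (∑ x, y a x * boolSign (ε x)) ^ 2) / 4)
      ≤ 2 ^ Fintype.card ι * Real.sqrt 2 ^ Fintype.card A := by
  have hprod : ∀ z : A → ℝ, ∀ g : A → ℝ, Real.exp (∑ a, (-g a ^ 2 + g a * z a))
      = ∏ a, Real.exp (-g a ^ 2 + g a * z a) := fun z g => Real.exp_sum _ _
  have hexp : ∀ z : A → ℝ, Real.exp ((∑ a, z a ^ 2) / 4)
      = (Real.sqrt Real.pi)⁻¹ ^ Fintype.card A
        * ∫ g : A → ℝ, Real.exp (∑ a, (-g a ^ 2 + g a * z a)) := by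
    intro z
    simp_rw [hprod]
    rw [MeasureTheory.integral_fintype_prod_volume_eq_prod
        (fun a (g : ℝ) => Real.exp (-g ^ 2 + g * z a)),
      Finset.sum_div, Real.exp_sum, ← Finset.card_univ, ← Finset.prod_const,
      ← Finset.prod_mul_distrib]
    exact Finset.prod_congr rfl fun a _ => exp_sq_div_four_eq_integral (z a)
  have hint : ∀ z : A → ℝ,
      MeasureTheory.Integrable fun g : A → ℝ => Real.exp (∑ a, (-g a ^ 2 + g a * z a)) := by
    intro z
    simp_rw [hprod]
    exact MeasureTheory.Integrable.fintype_prod fun a => integrable_exp_neg_sq_add_mul (z a)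
  have hhalf : ∀ g : A → ℝ, Real.exp (-(∑ a, g a ^ 2) / 2)
      = ∏ a, Real.exp (-(1 / 2) * g a ^ 2) := by
    intro g
    rw [← Real.exp_sum]; congr 1; rw [← Finset.mul_sum]; ring
  have hint2 : MeasureTheory.Integrable fun g : A → ℝ => Real.exp (-(∑ a, g a ^ 2) / 2) := by
    simp_rw [hhalf]
    exact MeasureTheory.Integrable.fintype_prod
      fun a => integrable_exp_neg_mul_sq (by norm_num : (0 : ℝ) < 1 / 2)
  have hgauss : ∫ g : A → ℝ, Real.exp (-(∑ a, g a ^ 2) / 2)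
      = Real.sqrt (Real.pi * 2) ^ Fintype.card A := by
    simp_rw [hhalf]
    rw [MeasureTheory.integral_fintype_prod_volume_eq_prod
      (fun (_ : A) (g : ℝ) => Real.exp (-(1 / 2) * g ^ 2))]
    rw [integral_gaussian, Finset.prod_const, Finset.card_univ]
    norm_num
  simp_rw [hexp]
  rw [← Finset.mul_sum, ← MeasureTheory.integral_finsetSum _ fun ε _ => hint _]
  -- Averaging over the signs costs at most `exp (|g|²/2)` by `hy`, so half of the Gaussian weight
  -- `exp (-|g|²)` survives. Its integral, normalised by `π^(-|A|/2)`, gives the factor `√2^|A|`.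
  have hpt : ∀ g : A → ℝ, ∑ ε : ι → Bool,
      Real.exp (∑ a, (-g a ^ 2 + g a * ∑ x, y a x * boolSign (ε x)))
      ≤ 2 ^ Fintype.card ι * Real.exp (-(∑ a, g a ^ 2) / 2) := by
    intro g
    have e1 : ∀ ε : ι → Bool,
        Real.exp (∑ a, (-g a ^ 2 + g a * ∑ x, y a x * boolSign (ε x)))
        = Real.exp (-∑ a, g a ^ 2)
          * Real.exp (∑ x, (∑ a, g a * y a x) * boolSign (ε x)) := by
      intro ε
      rw [← Real.exp_add, Finset.sum_add_distrib, Finset.sum_neg_distrib]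
      congr 2
      simp_rw [Finset.mul_sum, Finset.sum_mul]
      rw [Finset.sum_comm]
      simp_rw [mul_assoc]
    simp_rw [e1]
    rw [← Finset.mul_sum]
    refine (mul_le_mul_of_nonneg_left (sum_exp_linear_boolSign_le _) (Real.exp_pos _).le).trans ?_
    rw [mul_left_comm, ← Real.exp_add]
    gcongr
    linarith [hy g]
  refine (mul_le_mul_of_nonneg_left (MeasureTheory.integral_mono
    (MeasureTheory.integrable_finsetSum _ fun ε _ => hint _) (hint2.const_mul _) hpt)
    (by positivity)).trans ?_
  rw [MeasureTheory.integral_const_mul, hgauss, mul_left_comm, ← mul_pow,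
    Real.sqrt_mul Real.pi_pos.le, ← mul_assoc, inv_mul_cancel₀ (by positivity), one_mul]

theorem star_dotProduct_self {B : Type*} [Fintype B] (z : B → ℂ) :
    star z ⬝ᵥ z = ((∑ x, ‖z x‖ ^ 2 : ℝ) : ℂ) := by
  simp only [dotProduct, Pi.star_apply]
  push_cast
  exact Finset.sum_congr rfl fun y _ => RCLike.conj_mul (z y)

/-- Complex version of `sum_exp_quarter_sq_le`, for orthonormal columns. -/
theorem sum_exp_quarter_norm_sq_le {ι A : Type*} [Fintype ι] [DecidableEq ι] [Fintype A]
    [DecidableEq A] (U : Matrix ι A ℂ) (hU : Uᴴ * U = 1) :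
    ∑ ε : ι → Bool, Real.exp ((∑ a, ‖∑ x, star (U x a) * (boolSign (ε x) : ℂ)‖ ^ 2) / 4)
      ≤ 2 ^ Fintype.card ι * 2 ^ Fintype.card A := by
  -- Real and imaginary parts of the columns serve as separate real vectors; doubling the index set
  -- turns `√2^|A|` into `2^|A|`.
  have h := sum_exp_quarter_sq_le (ι := ι) (A := A ⊕ A)
    (Sum.elim (fun a x => (U x a).re) (fun a x => (U x a).im)) ?_
  · have e : Real.sqrt 2 ^ Fintype.card (A ⊕ A) = 2 ^ Fintype.card A := by
      rw [Fintype.card_sum, ← two_mul, pow_mul, Real.sq_sqrt (by norm_num)]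
    rw [e] at h
    refine le_of_eq_of_le (Finset.sum_congr rfl fun ε _ => ?_) h
    congr 2
    rw [Fintype.sum_sum_type, ← Finset.sum_add_distrib]
    refine Finset.sum_congr rfl fun a _ => ?_
    rw [← Complex.normSq_eq_norm_sq, Complex.normSq_apply]
    simp [Complex.re_sum, Complex.im_sum]
    ring
  · intro g
    -- With these complex coefficients the required real combination is the real part of `U *ᵥ v`,
    -- and `U` preserves the norm.
    have hn : ∑ x, ‖∑ a, (U x a) * ((g (Sum.inl a) : ℂ) - Complex.I * g (Sum.inr a))‖ ^ 2
        = ∑ a, g a ^ 2 := by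
      set v : A → ℂ := fun a => (g (Sum.inl a) : ℂ) - Complex.I * g (Sum.inr a) with hv
      have h1 : star (U *ᵥ v) ⬝ᵥ (U *ᵥ v) = star v ⬝ᵥ v := by
        rw [Matrix.star_mulVec, ← Matrix.dotProduct_mulVec, Matrix.mulVec_mulVec, hU,
          Matrix.one_mulVec]
      rw [star_dotProduct_self, star_dotProduct_self] at h1
      have h3 : ∑ x, ‖(U *ᵥ v) x‖ ^ 2 = ∑ a, ‖v a‖ ^ 2 := by exact_mod_cast h1
      refine Eq.trans h3 ?_
      rw [Fintype.sum_sum_type, ← Finset.sum_add_distrib]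
      refine Finset.sum_congr rfl fun a _ => ?_
      rw [← Complex.normSq_eq_norm_sq, Complex.normSq_apply]
      simp [hv]
      ring
    rw [← hn]
    refine Finset.sum_le_sum fun x _ => ?_
    rw [← Complex.normSq_eq_norm_sq, Complex.normSq_apply]
    have : (∑ a, U x a * ((g (Sum.inl a) : ℂ) - Complex.I * g (Sum.inr a))).re
        = ∑ a, g a * Sum.elim (fun a x => (U x a).re) (fun a x => (U x a).im) a x := by
      rw [Fintype.sum_sum_type, ← Finset.sum_add_distrib, Complex.re_sum]
      refine Finset.sum_congr rfl fun a _ => ?_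
      simp
      ring
    rw [this, ← pow_two]
    nlinarith [mul_self_nonneg
      (∑ a, U x a * ((g (Sum.inl a) : ℂ) - Complex.I * g (Sum.inr a))).im]

-- Markov's inequality for the exponential moment.
open Classical in
theorem card_filter_norm_sq_ge_le {ι A : Type*} [Fintype ι] [DecidableEq ι] [Fintype A]
    [DecidableEq A] (U : Matrix ι A ℂ) (hU : Uᴴ * U = 1) (t : ℝ) :
    ((Finset.univ.filter fun ε : ι → Bool =>
        t ≤ ∑ a, ‖∑ x, star (U x a) * (boolSign (ε x) : ℂ)‖ ^ 2).card : ℝ)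
      ≤ 2 ^ Fintype.card ι * 2 ^ Fintype.card A * Real.exp (-t / 4) := by
  have h := sum_exp_quarter_norm_sq_le U hU
  set F : (ι → Bool) → ℝ := fun ε => ∑ a, ‖∑ x, star (U x a) * (boolSign (ε x) : ℂ)‖ ^ 2
  have h1 : ((Finset.univ.filter fun ε => t ≤ F ε).card : ℝ) * Real.exp (t / 4)
      ≤ ∑ ε, Real.exp (F ε / 4) := by
    rw [← nsmul_eq_mul]
    refine (Finset.card_nsmul_le_sum (Finset.univ.filter fun ε => t ≤ F ε)
      (fun ε => Real.exp (F ε / 4)) _ fun ε hε => ?_).trans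
      (Finset.sum_le_univ_sum_of_nonneg fun ε => (Real.exp_pos _).le)
    have := (Finset.mem_filter.mp hε).2
    gcongr
  rw [neg_div, Real.exp_neg, ← div_eq_mul_inv, le_div_iff₀ (Real.exp_pos _)]
  exact h1.trans h

/-- Orthogonality of distinct rows of signs on average. -/
theorem sum_boolSign_row_mul_sq {ι Y : Type*} [Fintype ι] [DecidableEq ι] [Fintype Y]
    [DecidableEq Y] {i j : ι} (hij : i ≠ j) :
    ∑ ε : ι × Y → Bool, (∑ y, boolSign (ε (i, y)) * boolSign (ε (j, y))) ^ 2
      = 2 ^ Fintype.card (ι × Y) * Fintype.card Y := by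
  have h1 : ∀ y z : Y, ∑ ε : ι × Y → Bool,
      (boolSign (ε (i, y)) * boolSign (ε (j, y))) * (boolSign (ε (i, z)) * boolSign (ε (j, z)))
      = if y = z then 2 ^ Fintype.card (ι × Y) else 0 := by
    intro y z
    split_ifs with hyz
    · subst hyz
      have : ∀ ε : ι × Y → Bool, (boolSign (ε (i, y)) * boolSign (ε (j, y)))
          * (boolSign (ε (i, y)) * boolSign (ε (j, y))) = 1 := fun ε => by
        rw [mul_mul_mul_comm, boolSign_mul_self, boolSign_mul_self, one_mul]
      simp [this]
    -- Flipping the single sign at `(i, y)` negates the summand, because `y ≠ z` and `i ≠ j` leave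
    -- the other three factors alone; hence the sum vanishes.
    · let flip : (ι × Y → Bool) → (ι × Y → Bool) :=
        fun ε => Function.update ε (i, y) (!ε (i, y))
      have hflip : Function.Involutive flip := by
        intro ε; simp [flip]
      have h := Equiv.sum_comp hflip.toPerm fun ε : ι × Y → Bool =>
        (boolSign (ε (i, y)) * boolSign (ε (j, y)))
          * (boolSign (ε (i, z)) * boolSign (ε (j, z)))
      have h2 : ∀ ε : ι × Y → Bool, (boolSign (flip ε (i, y))
          * boolSign (flip ε (j, y))) * (boolSign (flip ε (i, z))
          * boolSign (flip ε (j, z))) = -((boolSign (ε (i, y)) * boolSign (ε (j, y)))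
          * (boolSign (ε (i, z)) * boolSign (ε (j, z)))) := by
        intro ε
        have hzy : z ≠ y := fun h => hyz h.symm
        simp [flip, hij.symm, hzy, boolSign_not]
      simp only [Function.Involutive.coe_toPerm, h2] at h
      rw [Finset.sum_neg_distrib] at h
      linarith
  simp_rw [sq, Finset.sum_mul_sum]
  rw [Finset.sum_comm]
  simp_rw [Finset.sum_comm (s := (Finset.univ : Finset (ι × Y → Bool))), h1]
  simp [mul_comm]

/-! ### Greedy selection in a digraph -/

/-- A digraph with small in-degrees has large independent sets. -/
theorem exists_independent_of_inDegree_le {Ω : Type*} [DecidableEq Ω] (bad : Ω → Ω → Prop)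
    [DecidableRel bad] (B : ℕ) (N : ℕ) : ∀ G : Finset Ω,
    (∀ y ∈ G, (G.filter fun x => bad x y).card ≤ B) → N * (2 * B + 1) ≤ G.card →
    ∃ f : Fin N → Ω, (∀ i, f i ∈ G) ∧ ∀ i j, i ≠ j → ¬ bad (f i) (f j) := by
  induction N with
  | zero => intro G _ _; exact ⟨Fin.elim0, fun i => i.elim0, fun i => i.elim0⟩
  | succ N ih =>
    intro G hin hcard
    have hne : G.Nonempty := by
      rw [← Finset.card_pos]; nlinarith
    -- In- and out-degrees have the same sum, so some vertex has out-degree at most `B`. Removing it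
    -- with its neighbours in both directions costs at most `2 * B + 1` vertices.
    obtain ⟨x, hx, hout⟩ : ∃ x ∈ G, (G.filter fun y => bad x y).card ≤ B := by
      by_contra! hcon
      have h1 := Finset.sum_card_bipartiteAbove_eq_sum_card_bipartiteBelow (s := G) (t := G) bad
      have h2 : ∑ a ∈ G, (G.bipartiteBelow bad a).card ≤ ∑ a ∈ G, B :=
        Finset.sum_le_sum fun a ha => hin a ha
      have h3 : ∑ a ∈ G, B < ∑ a ∈ G, (G.bipartiteAbove bad a).card :=
        Finset.sum_lt_sum_of_nonempty hne fun a ha => hcon a ha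
      omega
    let R : Finset Ω := {x} ∪ (G.filter (fun y => bad x y) ∪ G.filter fun y => bad y x)
    have hR : R.card ≤ 2 * B + 1 := by
      refine (Finset.card_union_le _ _).trans ?_
      have := Finset.card_union_le (G.filter fun y => bad x y) (G.filter fun y => bad y x)
      have := hin x hx
      simp only [Finset.card_singleton]
      omega
    have hG' : N * (2 * B + 1) ≤ (G \ R).card := by
      have := Finset.le_card_sdiff R G
      have : (N + 1) * (2 * B + 1) = N * (2 * B + 1) + (2 * B + 1) := by ring
      omega
    obtain ⟨f, hf, hbad⟩ := ih (G \ R) (fun y hy =>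
      (Finset.card_le_card (Finset.filter_subset_filter _ Finset.sdiff_subset)).trans
        (hin y (Finset.mem_sdiff.mp hy).1)) hG'
    have hfx : ∀ i, ¬ bad x (f i) ∧ ¬ bad (f i) x := by
      intro i
      obtain ⟨h1, h2⟩ := Finset.mem_sdiff.mp (hf i)
      simp only [R, Finset.mem_union, Finset.mem_filter, h1, true_and, not_or] at h2
      exact h2.2
    refine ⟨Fin.cons x f, fun i => ?_, fun i j hij => ?_⟩
    · refine Fin.cases hx (fun i => (Finset.mem_sdiff.mp (hf i)).1) i
    · induction i using Fin.cases with
      | zero =>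
        induction j using Fin.cases with
        | zero => exact absurd rfl hij
        | succ j => simpa using (hfx j).1
      | succ i =>
        induction j using Fin.cases with
        | zero => simpa using (hfx i).2
        | succ j => simpa using hbad i j fun h => hij (by rw [h])

/-! ### Channels in Stinespring form -/

section Channel

variable {ι κ l : Type*} [Fintype ι] [Fintype l]

/-- The map `X ↦ Tr_l (W X Wᴴ)` with Stinespring operator `W : ℂ^ι → ℂ^κ ⊗ ℂ^l`. -/
def stinespring (W : Matrix (κ × l) ι ℂ) : Matrix ι ι ℂ →ₗ[ℂ] Matrix κ κ ℂ where
  toFun X := Matrix.of fun a b => ∑ k, (W * X * Wᴴ) (a, k) (b, k)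
  map_add' X Y := by
    ext a b
    simp [Matrix.mul_add, Matrix.add_mul, Finset.sum_add_distrib]
  map_smul' c X := by
    ext a b
    simp [Finset.mul_sum]

theorem stinespring_apply (W : Matrix (κ × l) ι ℂ) (X : Matrix ι ι ℂ) (a b : κ) :
    stinespring W X a b = ∑ k, (W * X * Wᴴ) (a, k) (b, k) := rfl

theorem idTensor_stinespring {α : Type*} [Fintype α] [DecidableEq α] (W : Matrix (κ × l) ι ℂ)
    (M : Matrix (α × ι) (α × ι) ℂ) :
    idTensor (stinespring W) M = ∑ k, (((1 : Matrix α α ℂ) ⊗ₖ W) * M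
      * ((1 : Matrix α α ℂ) ⊗ₖ W)ᴴ).submatrix (fun p : α × κ => (p.1, (p.2, k)))
        (fun p : α × κ => (p.1, (p.2, k))) := by
  ext ⟨n, a⟩ ⟨m, b⟩
  simp [idTensor, stinespring_apply, Matrix.sum_apply, Matrix.mul_apply, Fintype.sum_prod_type,
    Matrix.one_apply, apply_ite (starRingEnd ℂ)]

theorem isQuantumChannel_stinespring [DecidableEq ι] [Fintype κ] [DecidableEq κ]
    (W : Matrix (κ × l) ι ℂ) (hW : Wᴴ * W = 1) :
    IsQuantumChannel (stinespring W) where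
  completelyPositive := by
    rw [isCompletelyPositive_iff]
    intro n M hM
    rw [idTensor_stinespring]
    exact Matrix.posSemidef_sum _ fun k _ => (hM.mul_mul_conjTranspose_same _).submatrix _
  tracePreserving X := by
    have : (stinespring W X).trace = (W * X * Wᴴ).trace := by
      simp [Matrix.trace, stinespring_apply, Fintype.sum_prod_type]
    rw [this, Matrix.trace_mul_comm, ← Matrix.mul_assoc, hW, Matrix.one_mul]

end Channel

/-! ### From isometries to identification codes -/

section Code

variable {d : ℕ} {κ l : Type*} [Fintype κ] [Fintype l]

/-- The columns are the vectors `(1 ⊗ A_k)|Φ_d⟩` for the Kraus operators `A_k` of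
`stinespring W`. -/
noncomputable def krausVectors (W : Matrix (κ × l) (Fin d) ℂ) : Matrix (Fin d × κ) l ℂ :=
  Matrix.of fun p k => ((1 / Real.sqrt d : ℝ) : ℂ) * W (p.2, k) p.1

/-- Each Kraus operator maps `|Φ_d⟩` to a single vector. This factorisation makes overlaps into
Frobenius norms and bounds the rank by the size of the environment `l`. -/
theorem idTensor_maxEntangledState {κ : Type*} (W : Matrix (κ × l) (Fin d) ℂ) :
    idTensor (stinespring W) (maxEntangledState d) = krausVectors W * (krausVectors W)ᴴ := by
  ext ⟨n, a⟩ ⟨m, b⟩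
  simp only [idTensor, stinespring_apply, Matrix.mul_apply, Matrix.of_apply, maxEntangledState,
    Matrix.vecMulVec_apply, maxEntangledVec, Pi.star_apply, Matrix.conjTranspose_apply,
    krausVectors]
  refine Finset.sum_congr rfl fun k _ => ?_
  simp [apply_ite (starRingEnd ℂ)]
  ring

theorem krausVectors_sub {κ l : Type*} (V W : Matrix (κ × l) (Fin d) ℂ) :
    krausVectors (V - W) = krausVectors V - krausVectors W := by
  ext p k
  simp [krausVectors, mul_sub]

theorem frobSq_krausVectors (W : Matrix (κ × l) (Fin d) ℂ) :
    frobSq (krausVectors W) = frobSq W / d := by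
  have h : ∀ x : ℂ, ‖((1 / Real.sqrt d : ℝ) : ℂ) * x‖ ^ 2 = ‖x‖ ^ 2 / d := by
    intro x
    rw [norm_mul, Complex.norm_real, mul_pow, Real.norm_eq_abs, sq_abs, div_pow,
      Real.sq_sqrt (Nat.cast_nonneg d)]
    ring
  simp only [frobSq, krausVectors, Matrix.of_apply, h, Fintype.sum_prod_type, ← Finset.sum_div]
  congr 1
  rw [Finset.sum_comm]
  refine Finset.sum_congr rfl fun a _ => ?_
  rw [Finset.sum_comm]

theorem frobSq_krausVectors_of_isometry (hd : 0 < d) (W : Matrix (κ × l) (Fin d) ℂ)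
    (hW : Wᴴ * W = 1) : frobSq (krausVectors W) = 1 := by
  have h := trace_conjTranspose_mul_self_eq_frobSq W
  rw [hW, Matrix.trace_one, Fintype.card_fin] at h
  have h2 : frobSq W = d := by exact_mod_cast h.symm
  rw [frobSq_krausVectors, h2, div_self (by positivity)]

theorem re_trace_mul_isometry {m n p : Type*} [Fintype m] [Fintype n] [Fintype p]
    (M : Matrix m n ℂ) (U : Matrix m p ℂ) :
    (M * Mᴴ * (U * Uᴴ)).trace.re = frobSq (Uᴴ * M) := by
  have h : (M * Mᴴ * (U * Uᴴ)).trace = ((Uᴴ * M)ᴴ * (Uᴴ * M)).trace := by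
    rw [Matrix.conjTranspose_mul, Matrix.conjTranspose_conjTranspose, Matrix.mul_assoc,
      Matrix.trace_mul_comm]
    simp only [Matrix.mul_assoc]
  rw [h, trace_conjTranspose_mul_self_eq_frobSq, Complex.ofReal_re]

/-- The first-kind error vanishes because a state is fixed by its own support projection; only the
cross overlaps remain to be controlled. -/
theorem isIDCodeOn_of_isometries [DecidableEq κ] {I : Type*} (hd : 0 < d) (W : I → Matrix (κ × l) (Fin d) ℂ)
    (hW : ∀ i, (W i)ᴴ * W i = 1) (lam : ℝ)
    (h : ∀ i j, i ≠ j → (krausVectors (W i) * (krausVectors (W i))ᴴ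
      * suppProj (krausVectors (W j) * (krausVectors (W j))ᴴ)).trace.re ≤ lam) :
    IsIDCodeOn (fun i => idTensor (stinespring (W i)) (maxEntangledState d))
      (fun i => suppProj (idTensor (stinespring (W i)) (maxEntangledState d))) 0 lam := by
  simp_rw [idTensor_maxEntangledState]
  have htr : ∀ i, (krausVectors (W i) * (krausVectors (W i))ᴴ).trace = 1 := by
    intro i
    rw [Matrix.trace_mul_comm, trace_conjTranspose_mul_self_eq_frobSq,
      frobSq_krausVectors_of_isometry hd _ (hW i), Complex.ofReal_one]
  refine ⟨fun i => ⟨Matrix.posSemidef_self_mul_conjTranspose _, htr i⟩, fun i => ?_, fun i => ?_,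
    fun i => ?_, h⟩
  · obtain ⟨U, hU, hP, -⟩ := exists_isometry_suppProj (krausVectors (W i) * (krausVectors (W i))ᴴ)
    rw [hP]
    exact Matrix.posSemidef_self_mul_conjTranspose _
  · obtain ⟨U, hU, hP, -⟩ := exists_isometry_suppProj (krausVectors (W i) * (krausVectors (W i))ᴴ)
    rw [hP, ← isometry_compl_idempotent U hU]
    exact Matrix.posSemidef_conjTranspose_mul_self _
  · obtain ⟨U, hU, hP, hs⟩ := exists_isometry_suppProj (krausVectors (W i) * (krausVectors (W i))ᴴ)
    rw [LinearMap.id_apply, Matrix.trace_mul_comm, hs, htr i]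
    simp

theorem re_trace_mul_suppProj_le_one {m n : Type*} [Fintype m] [DecidableEq m] [Fintype n]
    (M : Matrix m n ℂ) (ρ : Matrix m m ℂ) (hM : frobSq M = 1) :
    (M * Mᴴ * suppProj ρ).trace.re ≤ 1 := by
  obtain ⟨U, hU, hP, -⟩ := exists_isometry_suppProj ρ
  rw [hP, re_trace_mul_isometry, ← hM]
  exact frobSq_conjTranspose_isometry_mul_le U hU M

end Code

/-! ### Random sign matrices -/

section Random

variable {d : ℕ} {κ l : Type*} [Fintype κ] [DecidableEq κ] [Fintype l] [DecidableEq l]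

/-- The matrix with entries `±1 / √|Y|`, with signs given by `ε`. -/
noncomputable def signMatrix {ι Y : Type*} [Fintype Y] (ε : ι × Y → Bool) : Matrix Y ι ℂ :=
  Matrix.of fun y j => ((1 / Real.sqrt (Fintype.card Y) * boolSign (ε (j, y)) : ℝ) : ℂ)

theorem gram_signMatrix {ι Y : Type*} [Fintype Y] (ε : ι × Y → Bool) (i j : ι) :
    ((signMatrix ε)ᴴ * signMatrix ε) i j
      = (((∑ y, boolSign (ε (i, y)) * boolSign (ε (j, y))) / Fintype.card Y : ℝ) : ℂ) := by
  rw [Matrix.mul_apply, Finset.sum_div]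
  push_cast
  refine Finset.sum_congr rfl fun y _ => ?_
  rw [Matrix.conjTranspose_apply, signMatrix, Matrix.of_apply, Matrix.of_apply,
    RCLike.star_def, Complex.conj_ofReal, ← Complex.ofReal_mul]
  have : (1 / Real.sqrt (Fintype.card Y) * boolSign (ε (i, y)))
      * (1 / Real.sqrt (Fintype.card Y) * boolSign (ε (j, y)))
      = boolSign (ε (i, y)) * boolSign (ε (j, y)) / Fintype.card Y := by
    rw [mul_mul_mul_comm, div_mul_div_comm, Real.mul_self_sqrt (Nat.cast_nonneg _)]
    ring
  rw [this]; push_cast; rfl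

/-- The diagonal of the Gram matrix is exactly `1`, and each off-diagonal entry has mean square
`1/|Y|`. -/
theorem sum_frobSq_gram_signMatrix_le {ι Y : Type*} [Fintype ι] [DecidableEq ι] [Fintype Y]
    [DecidableEq Y] [Nonempty Y] :
    ∑ ε : ι × Y → Bool, frobSq ((signMatrix ε)ᴴ * signMatrix ε - 1)
      ≤ 2 ^ Fintype.card (ι × Y) * ((Fintype.card ι : ℝ) ^ 2 / Fintype.card Y) := by
  have hY : (0 : ℝ) < Fintype.card Y := by exact_mod_cast Fintype.card_pos
  have hij : ∀ i j : ι, ∑ ε : ι × Y → Bool, ‖((signMatrix ε)ᴴ * signMatrix ε - (1 : Matrix ι ι ℂ)) i j‖ ^ 2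
      ≤ 2 ^ Fintype.card (ι × Y) / Fintype.card Y := by
    intro i j
    by_cases h : i = j
    · subst h
      have : ∀ ε : ι × Y → Bool, ((signMatrix ε)ᴴ * signMatrix ε - (1 : Matrix ι ι ℂ)) i i = 0 := by
        intro ε
        rw [Matrix.sub_apply, gram_signMatrix, Matrix.one_apply_eq]
        simp [boolSign_mul_self]
      simp only [this, norm_zero, ne_eq, OfNat.ofNat_ne_zero, not_false_eq_true, zero_pow,
        Finset.sum_const_zero]
      positivity
    · have : ∀ ε : ι × Y → Bool, ‖((signMatrix ε)ᴴ * signMatrix ε - (1 : Matrix ι ι ℂ)) i j‖ ^ 2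
          = (∑ y, boolSign (ε (i, y)) * boolSign (ε (j, y))) ^ 2 / (Fintype.card Y : ℝ) ^ 2 := by
        intro ε
        rw [Matrix.sub_apply, gram_signMatrix, Matrix.one_apply_ne h, sub_zero,
          Complex.norm_real, Real.norm_eq_abs, sq_abs, div_pow]
      simp_rw [this]
      rw [← Finset.sum_div, sum_boolSign_row_mul_sq h]
      apply le_of_eq
      field_simp
  simp only [frobSq]
  rw [Finset.sum_comm]
  simp_rw [Finset.sum_comm (s := (Finset.univ : Finset (ι × Y → Bool)))]
  refine (Finset.sum_le_sum fun i _ => Finset.sum_le_sum fun j _ => hij i j).trans (le_of_eq ?_)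
  simp only [Finset.sum_const, Finset.card_univ, nsmul_eq_mul]
  ring

/-- At least half of the sign matrices are close to isometries. -/
theorem card_signMatrix_near_isometry {ι Y : Type*} [Fintype ι] [DecidableEq ι] [Nonempty ι]
    [Fintype Y] [DecidableEq Y] [Nonempty Y] :
    (2 : ℝ) ^ Fintype.card (ι × Y) ≤ 2 * (Finset.univ.filter fun ε : ι × Y → Bool =>
      frobSq ((signMatrix ε)ᴴ * signMatrix ε - 1)
        ≤ 2 * ((Fintype.card ι : ℝ) ^ 2 / Fintype.card Y)).card := by
  set q : ℝ := (Fintype.card ι : ℝ) ^ 2 / Fintype.card Y with hq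
  have hq0 : 0 < q := by
    have h1 : (0 : ℝ) < Fintype.card Y := by exact_mod_cast Fintype.card_pos
    have h2 : (0 : ℝ) < Fintype.card ι := by exact_mod_cast Fintype.card_pos
    positivity
  set F : (ι × Y → Bool) → ℝ := fun ε => frobSq ((signMatrix ε)ᴴ * signMatrix ε - 1) with hF
  -- Markov's inequality: the mean is at most `q`, so at most half of the sign patterns exceed `2 *
  -- q`.
  have h1 : ((Finset.univ.filter fun ε => ¬ F ε ≤ 2 * q).card : ℝ) * (2 * q)
      ≤ 2 ^ Fintype.card (ι × Y) * q := by
    rw [← nsmul_eq_mul]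
    refine (Finset.card_nsmul_le_sum (Finset.univ.filter fun ε => ¬ F ε ≤ 2 * q) F _
      fun ε hε => (not_le.mp (Finset.mem_filter.mp hε).2).le).trans
      ((Finset.sum_le_univ_sum_of_nonneg fun ε => frobSq_nonneg _).trans
        sum_frobSq_gram_signMatrix_le)
  have h2 := Finset.card_filter_add_card_filter_not (s := Finset.univ) (fun ε => F ε ≤ 2 * q)
  rw [Finset.card_univ, Fintype.card_fun, Fintype.card_bool] at h2
  have h3 : ((Finset.univ.filter fun ε => F ε ≤ 2 * q).card : ℝ)
      + (Finset.univ.filter fun ε => ¬ F ε ≤ 2 * q).card = 2 ^ Fintype.card (ι × Y) := by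
    exact_mod_cast h2
  have h4 : ((Finset.univ.filter fun ε => ¬ F ε ≤ 2 * q).card : ℝ) * 2
      ≤ 2 ^ Fintype.card (ι × Y) := by
    nlinarith
  linarith

open Classical in
/-- Few sign matrices have a large component in a given subspace. -/
theorem card_signMatrix_large_overlap_le {A : Type*} [Fintype A] [DecidableEq A] [Nonempty κ]
    [Nonempty l] (hd : 0 < d) (U : Matrix (Fin d × κ) A ℂ) (hU : Uᴴ * U = 1) (μ : ℝ) :
    ((Finset.univ.filter fun ε : Fin d × (κ × l) → Bool =>
        μ ≤ frobSq (Uᴴ * krausVectors (signMatrix ε))).card : ℝ)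
      ≤ 2 ^ (d * (Fintype.card κ * Fintype.card l)) * 2 ^ (Fintype.card A * Fintype.card l)
        * Real.exp (-(μ * (d * (Fintype.card κ * Fintype.card l))) / 4) := by
  -- This is `U ⊗ 1` on the environment: projecting all Kraus vectors at once is one projection of
  -- the whole sign vector, with `|A| |l|` columns.
  let U' : Matrix (Fin d × (κ × l)) (A × l) ℂ :=
    Matrix.of fun x a => if x.2.2 = a.2 then U (x.1, x.2.1) a.1 else 0
  have hU' : U'ᴴ * U' = 1 := by
    ext ⟨a, k⟩ ⟨b, k'⟩
    have := congrFun (congrFun hU a) b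
    simp only [Matrix.mul_apply, Matrix.conjTranspose_apply, Fintype.sum_prod_type] at this
    by_cases hk : k = k'
    · subst hk
      rw [Matrix.one_apply] at this
      simpa [U', Matrix.mul_apply, Fintype.sum_prod_type, Matrix.one_apply,
        apply_ite (starRingEnd ℂ)] using this
    · have hk' : ¬ k' = k := fun h => hk h.symm
      simp [U', Matrix.mul_apply, Fintype.sum_prod_type, hk, hk', apply_ite (starRingEnd ℂ)]
  have h := card_filter_norm_sq_ge_le U' hU' (μ * (d * (Fintype.card κ * Fintype.card l)))
  simp only [Fintype.card_prod, Fintype.card_fin] at h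
  refine le_trans ?_ h
  have hn : (0 : ℝ) < d * (Fintype.card κ * Fintype.card l) := by
    have h1 : (0 : ℝ) < Fintype.card κ := by exact_mod_cast Fintype.card_pos
    have h2 : (0 : ℝ) < Fintype.card l := by exact_mod_cast Fintype.card_pos
    have h3 : (0 : ℝ) < d := by exact_mod_cast hd
    positivity
  have key : ∀ ε : Fin d × (κ × l) → Bool,
      ∑ a, ‖∑ x, star (U' x a) * (boolSign (ε x) : ℂ)‖ ^ 2
        = frobSq (Uᴴ * krausVectors (signMatrix ε)) * (d * (Fintype.card κ * Fintype.card l)) := by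
    intro ε
    simp only [frobSq, Finset.sum_mul, Fintype.sum_prod_type]
    refine Finset.sum_congr rfl fun a _ => Finset.sum_congr rfl fun k _ => ?_
    set r : ℝ := 1 / Real.sqrt d * (1 / Real.sqrt (Fintype.card (κ × l))) with hr
    have hr2 : r ^ 2 * (d * (Fintype.card κ * Fintype.card l)) = 1 := by
      rw [hr, mul_pow, div_pow, div_pow, Real.sq_sqrt (Nat.cast_nonneg _),
        Real.sq_sqrt (Nat.cast_nonneg _), Fintype.card_prod]
      push_cast
      have := hn.ne'
      field_simp
    have e : (Uᴴ * krausVectors (signMatrix ε)) a k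
        = (r : ℂ) * ∑ x, ∑ y, ∑ z, star (U' (x, y, z) (a, k)) * (boolSign (ε (x, y, z)) : ℂ) := by
      simp only [Matrix.mul_apply, Fintype.sum_prod_type, Matrix.conjTranspose_apply, krausVectors,
        signMatrix, Matrix.of_apply, Finset.mul_sum]
      refine Finset.sum_congr rfl fun x _ => Finset.sum_congr rfl fun y _ => ?_
      rw [Finset.sum_eq_single k]
      · simp only [U', Matrix.of_apply, if_true, hr]
        push_cast
        ring
      · intro z _ hz
        simp [U', hz]
      · simp
    rw [e, norm_mul, mul_pow, Complex.norm_real, Real.norm_eq_abs, sq_abs, mul_right_comm, hr2,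
      one_mul]
  rw [Nat.cast_le]
  refine Finset.card_le_card fun ε hε => ?_
  simp only [Finset.mem_filter, Finset.mem_univ, true_and] at hε ⊢
  rw [key ε]
  exact mul_le_mul_of_nonneg_right hε hn.le

end Random

/-! ### Selecting the code -/

theorem rank_krausVectors_mul_le {d : ℕ} {κ l : Type*} [Fintype κ] [Fintype l]
    (W : Matrix (κ × l) (Fin d) ℂ) :
    (krausVectors W * (krausVectors W)ᴴ).rank ≤ Fintype.card l :=
  (Matrix.rank_mul_le_left _ _).trans (Matrix.rank_le_card_width _)

/-- The three numerical conditions have separate roles: `hK_le` lets the tail bound absorb the rank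
factor, `hdim` makes the passage to a true isometry cost little, and `hlarge` leaves room for
`2^(d²)` codewords. -/
theorem exists_code_isometries {d Δ K : ℕ} {lam : ℝ} (hd : 0 < d) (hΔ : 0 < Δ) (hK : 0 < K)
    (hlam : lam ≤ 1) (hK_le : (K : ℝ) ≤ lam * d * Δ / 32) (hdim : 8 * (d : ℝ) ≤ lam * (Δ * K))
    (hlarge : (d : ℝ) ^ 2 + 3 ≤ lam * (d * (Δ * K)) / 32) (N : ℕ) (hN : N ≤ 2 ^ d ^ 2) :
    ∃ W : Fin N → Matrix (Fin Δ × Fin K) (Fin d) ℂ, (∀ i, (W i)ᴴ * W i = 1) ∧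
      ∀ i j, i ≠ j → (krausVectors (W i) * (krausVectors (W i))ᴴ
        * suppProj (krausVectors (W j) * (krausVectors (W j))ᴴ)).trace.re ≤ lam := by
  classical
  have : Nonempty (Fin Δ) := ⟨⟨0, hΔ⟩⟩
  have : Nonempty (Fin K) := ⟨⟨0, hK⟩⟩
  have : Nonempty (Fin d) := ⟨⟨0, hd⟩⟩
  have hd0 : (0 : ℝ) < d := by exact_mod_cast hd
  have hY0 : (0 : ℝ) < Δ * K := by
    have h1 : (0 : ℝ) < Δ := by exact_mod_cast hΔ
    have h2 : (0 : ℝ) < K := by exact_mod_cast hK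
    positivity
  have hcard : Fintype.card (Fin d) ≤ Fintype.card (Fin Δ × Fin K) := by
    simp only [Fintype.card_prod, Fintype.card_fin]
    have : (d : ℝ) ≤ Δ * K := by nlinarith
    exact_mod_cast this
  choose W hW1 hW2 using fun ε : Fin d × (Fin Δ × Fin K) → Bool =>
    exists_isometry_near hcard (signMatrix ε)
  let ρ : (Fin d × (Fin Δ × Fin K) → Bool) → Matrix (Fin d × Fin Δ) (Fin d × Fin Δ) ℂ :=
    fun ε => krausVectors (W ε) * (krausVectors (W ε))ᴴ
  let bad : (Fin d × (Fin Δ × Fin K) → Bool) → (Fin d × (Fin Δ × Fin K) → Bool) → Prop :=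
    fun ε ε' => ¬ (ρ ε * suppProj (ρ ε')).trace.re ≤ lam
  let G := Finset.univ.filter fun ε : Fin d × (Fin Δ × Fin K) → Bool =>
      frobSq ((signMatrix ε)ᴴ * signMatrix ε - 1)
        ≤ 2 * ((Fintype.card (Fin d) : ℝ) ^ 2 / Fintype.card (Fin Δ × Fin K))
  set n := d * (Δ * K) with hn
  set x : ℝ := lam * (d * (Δ * K)) / 32 with hx
  have hG : (2 : ℝ) ^ n ≤ 2 * G.card := by
    have := card_signMatrix_near_isometry (ι := Fin d) (Y := Fin Δ × Fin K)
    simp only [Fintype.card_prod, Fintype.card_fin] at this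
    simpa [G] using this
  -- The support of `ρ ε'` is held fixed while `ε` varies, so only in-degrees are bounded. An
  -- overlap above `lam` for `W ε` forces one of at least `lam / 4` for the sign matrix:
  -- `frobSq_add_le` doubles both terms, and the correction is at most `lam / 4`.
  have hbad : ∀ ε', ((G.filter fun ε => bad ε ε').card : ℝ) ≤ 2 ^ n * Real.exp (-x) := by
    intro ε'
    obtain ⟨U, hU, hP, -⟩ := exists_isometry_suppProj (ρ ε')
    have hsub : (G.filter fun ε => bad ε ε') ⊆ Finset.univ.filter
        fun ε : Fin d × (Fin Δ × Fin K) → Bool =>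
          lam / 4 ≤ frobSq (Uᴴ * krausVectors (signMatrix ε)) := by
      intro ε hε
      simp only [G, bad, Finset.mem_filter, Finset.mem_univ, true_and, not_le,
        Fintype.card_prod, Fintype.card_fin, Nat.cast_mul] at hε ⊢
      obtain ⟨hgood, hε⟩ := hε
      rw [hP, re_trace_mul_isometry] at hε
      have h1 : Uᴴ * krausVectors (W ε)
          = Uᴴ * krausVectors (signMatrix ε) + Uᴴ * krausVectors (W ε - signMatrix ε) := by
        rw [krausVectors_sub, ← Matrix.mul_add, add_sub_cancel]
      have h2 := frobSq_conjTranspose_isometry_mul_le U hU (krausVectors (W ε - signMatrix ε))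
      have h3 := frobSq_add_le (Uᴴ * krausVectors (signMatrix ε))
        (Uᴴ * krausVectors (W ε - signMatrix ε))
      rw [← h1] at h3
      rw [frobSq_krausVectors] at h2
      have h4 : frobSq (W ε - signMatrix ε) / d ≤ lam / 4 := by
        refine (div_le_div_of_nonneg_right ((hW2 ε).trans hgood) hd0.le).trans ?_
        rw [div_le_iff₀ hd0, ← mul_div_assoc, div_le_iff₀ hY0]
        nlinarith
      linarith
    have h1 := card_signMatrix_large_overlap_le (l := Fin K) hd U hU (lam / 4)
    simp only [Fintype.card_fin, ← hn] at h1
    have h2 : ((G.filter fun ε => bad ε ε').card : ℝ) ≤ _ :=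
      (Nat.cast_le.mpr (Finset.card_le_card hsub)).trans h1
    refine h2.trans ?_
    rw [mul_assoc]
    refine mul_le_mul_of_nonneg_left ?_ (by positivity)
    have hr : (ρ ε').rank ≤ K := (rank_krausVectors_mul_le (W ε')).trans_eq (Fintype.card_fin K)
    have h3 : (2 : ℝ) ^ ((ρ ε').rank * K) ≤ Real.exp (K * K) := by
      calc (2 : ℝ) ^ ((ρ ε').rank * K) ≤ 2 ^ (K * K) :=
            pow_le_pow_right₀ (by norm_num) (Nat.mul_le_mul_right _ hr)
        _ ≤ Real.exp 1 ^ (K * K) :=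
            pow_le_pow_left₀ (by norm_num) (by linarith [Real.add_one_le_exp (1 : ℝ)]) _
        _ = Real.exp (K * K) := by rw [← Real.exp_nat_mul]; push_cast; ring_nf
    refine (mul_le_mul_of_nonneg_right h3 (Real.exp_pos _).le).trans ?_
    rw [← Real.exp_add]
    refine Real.exp_le_exp.mpr ?_
    have h4 : (K : ℝ) * K ≤ lam * d * Δ / 32 * K :=
      mul_le_mul_of_nonneg_right hK_le (Nat.cast_nonneg _)
    rw [hx]
    linarith
  set B := ⌊(2 : ℝ) ^ n * Real.exp (-x)⌋₊ with hB
  -- The `+ 3` in `hlarge` supplies a factor `8`: the left side is at most `2^n/4 + 2^n/8`, below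
  -- the `2^n/2` elements guaranteed in `G`.
  have hsize : N * (2 * B + 1) ≤ G.card := by
    have hN' : (N : ℝ) ≤ 2 ^ d ^ 2 := by exact_mod_cast hN
    have hBle : (B : ℝ) ≤ 2 ^ n * Real.exp (-x) := Nat.floor_le (by positivity)
    have h1 : (2 : ℝ) ^ (d ^ 2 + 3) ≤ Real.exp x := by
      calc (2 : ℝ) ^ (d ^ 2 + 3) ≤ Real.exp 1 ^ (d ^ 2 + 3) :=
            pow_le_pow_left₀ (by norm_num) (by linarith [Real.add_one_le_exp (1 : ℝ)]) _
        _ = Real.exp ((d : ℝ) ^ 2 + 3) := by rw [← Real.exp_nat_mul]; push_cast; ring_nf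
        _ ≤ Real.exp x := Real.exp_le_exp.mpr hlarge
    have h2 : (2 : ℝ) ^ d ^ 2 * Real.exp (-x) ≤ 1 / 8 := by
      rw [Real.exp_neg, ← div_eq_mul_inv, div_le_iff₀ (Real.exp_pos _)]
      rw [pow_add] at h1
      linarith
    have h3 : d ^ 2 + 3 ≤ n := by
      have : (d : ℝ) ^ 2 + 3 ≤ d * (Δ * K) := by
        have : 0 < (d : ℝ) * (Δ * K) := by positivity
        nlinarith
      exact_mod_cast this
    have h4 : (2 : ℝ) ^ d ^ 2 * 8 ≤ 2 ^ n := by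
      have : (2 : ℝ) ^ (d ^ 2 + 3) ≤ 2 ^ n := pow_le_pow_right₀ (by norm_num) h3
      rw [pow_add] at this
      linarith
    have h5 : (N : ℝ) * (2 * B + 1) ≤ G.card := by
      calc (N : ℝ) * (2 * B + 1) ≤ 2 ^ d ^ 2 * (2 * (2 ^ n * Real.exp (-x)) + 1) := by gcongr
        _ = 2 * 2 ^ n * (2 ^ d ^ 2 * Real.exp (-x)) + 2 ^ d ^ 2 := by ring
        _ ≤ 2 * 2 ^ n * (1 / 8) + 2 ^ d ^ 2 := by gcongr
        _ ≤ G.card := by linarith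
    exact_mod_cast h5
  obtain ⟨f, -, hf⟩ := exists_independent_of_inDegree_le bad B N G
    (fun ε' _ => Nat.le_floor (hbad ε')) hsize
  exact ⟨fun i => W (f i), fun i => hW1 _, fun i j hij => not_not.mp (hf i j hij)⟩

end QuantumID

/-! ### Choice of the environment dimension -/

theorem mainTheorem2 (lam : ℝ) (hlam : 0 < lam) (d Δ : ℕ) (hd : 2 ≤ d) (hΔ_pos : 0 < Δ)
    (hΔ : 900 / lam ^ 2 * Real.logb 2 (30 * (d : ℝ) / lam) * Real.logb 2 (d : ℝ) ≤ (Δ : ℝ)) :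
    ∃ T : Fin ⌈(1 / 2 : ℝ) * (2 : ℝ) ^ (d ^ 2)⌉₊ →
        (Matrix (Fin d) (Fin d) ℂ →ₗ[ℂ] Matrix (Fin Δ) (Fin Δ) ℂ),
      (∀ i, QuantumID.IsQuantumChannel (T i)) ∧
      QuantumID.IsIDCodeOn
        (fun i => QuantumID.idTensor (T i) (QuantumID.maxEntangledState d))
        (fun i => QuantumID.suppProj
          (QuantumID.idTensor (T i) (QuantumID.maxEntangledState d)))
        0 lam := by
  have hd_pos : 0 < d := by omega
  suffices h : ∃ (K : ℕ) (W : Fin ⌈(1 / 2 : ℝ) * (2 : ℝ) ^ (d ^ 2)⌉₊ →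
      Matrix (Fin Δ × Fin K) (Fin d) ℂ), (∀ i, (W i)ᴴ * W i = 1) ∧
      ∀ i j, i ≠ j → (QuantumID.krausVectors (W i) * (QuantumID.krausVectors (W i))ᴴ
        * QuantumID.suppProj (QuantumID.krausVectors (W j)
          * (QuantumID.krausVectors (W j))ᴴ)).trace.re ≤ lam by
    obtain ⟨K, W, hW, hlt⟩ := h
    exact ⟨fun i => QuantumID.stinespring (W i),
      fun i => QuantumID.isQuantumChannel_stinespring _ (hW i),
      QuantumID.isIDCodeOn_of_isometries hd_pos W hW lam hlt⟩
  rcases le_or_gt 1 lam with h1 | h1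
  -- For `lam ≥ 1` the second-kind condition is trivial, so one arbitrary isometry, obtained here
  -- from the zero matrix, serves for every message.
  · obtain ⟨W, hW, -⟩ := QuantumID.exists_isometry_near (Y := Fin Δ × Fin d) (ι := Fin d)
      (by simpa using Nat.le_mul_of_pos_left d hΔ_pos) 0
    exact ⟨d, fun _ => W, fun _ => hW, fun i j _ =>
      (QuantumID.re_trace_mul_suppProj_le_one _ _
        (QuantumID.frobSq_krausVectors_of_isometry hd_pos W hW)).trans h1⟩
  have hd2 : (2 : ℝ) ≤ d := by exact_mod_cast hd
  have hd0 : (0 : ℝ) < d := by linarith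
  have hΔ0 : (0 : ℝ) < Δ := by exact_mod_cast hΔ_pos
  have hlogd : 1 ≤ Real.logb 2 d := by
    rw [Real.le_logb_iff_rpow_le (by norm_num) hd0]; simpa using hd2
  have hlog30 : 1 ≤ Real.logb 2 (30 * d / lam) := by
    rw [Real.le_logb_iff_rpow_le (by norm_num) (by positivity), Real.rpow_one, le_div_iff₀ hlam]
    linarith
  -- Both logarithms are at least `1`, and `Δ ≥ 900 / lam²` is all that the construction needs.
  have hmain : 900 ≤ lam ^ 2 * Δ := by
    have h2 : 900 / lam ^ 2 ≤ Δ := by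
      refine le_trans ?_ hΔ
      rw [mul_assoc]
      exact le_mul_of_one_le_right (by positivity) (one_le_mul_of_one_le_of_one_le hlog30 hlogd)
    rw [div_le_iff₀ (by positivity)] at h2
    linarith
  have hlamΔ : 900 ≤ lam * Δ := by nlinarith [mul_pos hlam hΔ0]
  have hsq : 810000 ≤ (lam * Δ) ^ 2 := by nlinarith
  -- `K = ⌊z⌋₊` is the largest environment dimension allowed by `hK_le`; since `z ≥ 1`, rounding
  -- down loses at most a factor `2`.
  set z : ℝ := lam * d * Δ / 32 with hz
  have hz1 : 1 ≤ z := by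
    rw [hz, le_div_iff₀ (by norm_num)]; nlinarith
  have hK1 : 1 ≤ ⌊z⌋₊ := Nat.le_floor (by simpa using hz1)
  have hKle : (⌊z⌋₊ : ℝ) ≤ z := Nat.floor_le (by linarith)
  have hKge : z / 2 ≤ (⌊z⌋₊ : ℝ) := by
    have h2 := Nat.lt_floor_add_one z
    have h3 : (1 : ℝ) ≤ ⌊z⌋₊ := by exact_mod_cast hK1
    linarith
  have hbase : (lam * Δ) ^ 2 * d / 64 ≤ lam * (Δ * ⌊z⌋₊) := by
    have := mul_le_mul_of_nonneg_left hKge (mul_pos hlam hΔ0).le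
    calc (lam * Δ) ^ 2 * d / 64 = lam * Δ * (z / 2) := by rw [hz]; ring
      _ ≤ lam * (Δ * ⌊z⌋₊) := by linarith
  -- Here `900² / 64 > 12000`. This gives `hdim` at once, and `hlarge` because `12000 / 32 = 375`
  -- and `d² + 3 ≤ 375 d²`.
  have hbase' : 12000 * (d : ℝ) ≤ lam * (Δ * ⌊z⌋₊) := by
    refine le_trans ?_ hbase
    have := mul_le_mul_of_nonneg_right hsq hd0.le
    linarith
  obtain ⟨W, hW⟩ := QuantumID.exists_code_isometries hd_pos hΔ_pos hK1 h1.le hKle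
    (by linarith) (by nlinarith) ⌈(1 / 2 : ℝ) * (2 : ℝ) ^ (d ^ 2)⌉₊ (by
      refine Nat.ceil_le.mpr ?_
      push_cast
      have : (0 : ℝ) < 2 ^ d ^ 2 := by positivity
      linarith)
  exact ⟨_, W, hW⟩
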